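/- Let $I$ be a set, let $\{A_i\}_{i\in I}$ be a family of unital C*-algebras, let $\tau_i$ be a tracial state on $A_i$ for each $i$, and write $\|a\|_{2}=\tau_i(a^*a)^{1/2}$ for $a\in A_i$. Let $\omega$ be a nontrivial ultrafilter on $I$, i.e. $\omega$ is not principal and there is a sequence $\{E_n\}$ of members of $\omega$ with $\bigcap_n E_n=\emptyset$. Let $\prod_{i} A_i$ be the C*-algebra of all bounded families $\{a_i\}$, with pointwise operations and the supremum norm, and let $$\mathcal J_2=\Big\{\{a_i\}\in\prod_{i}A_i:\ \lim_{i\to\omega}\|a_i\|_2=0\Big\},$$ which is a two-sided $*$-ideal. Then the tracial ultraproduct $\prod^\omega(A_i,\tau_i)=\big(\prod_i A_i\big)/\mathcal J_2$ is a von Neumann algebra, in the following sense. Let $\rho(\{a_i\})=\lim_{i\to\omega}\tau_i(a_i)$ be the limit trace on $\prod_i A_i$, and let $\pi_\rho$ be its GNS representation on the Hilbert space $H_\rho$. Then $\pi_\rho$ induces an isometric $*$-isomorphism from $\prod^\omega(A_i,\tau_i)$, with its quotient norm, onto a von Neumann algebra on $H_\rho$ (a $*$-subalgebra of $B(H_\rho)$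 that equals its double commutant). -/

import Mathlib

open Filter Topology
open scoped ENNReal ComplexOrder

universe u v

/-- A tracial state on a unital C⋆-algebra: a positive, unital, tracial linear functional. -/
structure TracialState (A : Type v) [CStarAlgebra A] where
  /-- The underlying linear functional. -/
  toLinearMap : A →ₗ[ℂ] ℂ
  star_mul_self_nonneg : ∀ a : A, 0 ≤ toLinearMap (star a * a)
  map_one : toLinearMap 1 = 1
  map_mul_comm : ∀ a b : A, toLinearMap (a * b) = toLinearMap (b * a)

/-- The seminorm `‖a‖₂ = τ(a⋆ a) ^ (1/2)`. -/
noncomputable def TracialState.norm₂ {A : Type v} [CStarAlgebra A] (τ : TracialState A) (a : A) :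
    ℝ :=
  √ (τ.toLinearMap (star a * a)).re

namespace TracialState

section

attribute [local instance] CStarAlgebra.spectralOrder CStarAlgebra.spectralOrderedRing

variable {A : Type v} [CStarAlgebra A] (τ : TracialState A)

/-- A tracial state as a positive linear map, for the order of the C⋆-algebra. -/
noncomputable def toPositive : A →ₚ[ℂ] ℂ :=
  PositiveLinearMap.mk₀ τ.toLinearMap fun a ha => by
    obtain ⟨b, rfl⟩ := CStarAlgebra.nonneg_iff_eq_star_mul_self.mp ha
    exact τ.star_mul_self_nonneg b

theorem norm₂_eq (a : A) : τ.norm₂ a = ‖τ.toPositive.toPreGNS a‖ := rfl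

theorem norm₂_nonneg (a : A) : 0 ≤ τ.norm₂ a := Real.sqrt_nonneg _

theorem norm₂_zero : τ.norm₂ 0 = 0 := by simp [norm₂]

theorem norm₂_one : τ.norm₂ 1 = 1 := by simp [norm₂, τ.map_one]

theorem norm₂_star (a : A) : τ.norm₂ (star a) = τ.norm₂ a := by
  simp [norm₂, τ.map_mul_comm a]

theorem norm₂_add_le (a b : A) : τ.norm₂ (a + b) ≤ τ.norm₂ a + τ.norm₂ b := by
  simp only [norm₂_eq, map_add]
  exact norm_add_le _ _

theorem norm₂_mul_le (a b : A) : τ.norm₂ (a * b) ≤ ‖a‖ * τ.norm₂ b := by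
  simp only [norm₂_eq]
  exact (τ.toPositive.leftMulMapPreGNS a).le_of_opNorm_le
    (LinearMap.mkContinuous_norm_le _ (norm_nonneg a) _) (τ.toPositive.toPreGNS b)

theorem norm₂_mul_le' (a b : A) : τ.norm₂ (a * b) ≤ τ.norm₂ a * ‖b‖ := by
  rw [← norm₂_star, star_mul, mul_comm, ← τ.norm₂_star a, ← norm_star b]
  exact τ.norm₂_mul_le _ _

theorem norm_apply_le (a : A) : ‖τ.toLinearMap a‖ ≤ ‖a‖ := by
  have h := norm_inner_le_norm (𝕜 := ℂ) (τ.toPositive.toPreGNS 1) (τ.toPositive.toPreGNS a)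
  rw [PositiveLinearMap.preGNS_inner_def, ← norm₂_eq, ← norm₂_eq, norm₂_one, one_mul] at h
  have h' := τ.norm₂_mul_le a 1
  rw [norm₂_one, mul_one, mul_one] at h'
  have h'' : star (τ.toPositive.ofPreGNS (τ.toPositive.toPreGNS 1)) *
      τ.toPositive.ofPreGNS (τ.toPositive.toPreGNS a) = a := by simp
  rw [h''] at h
  exact h.trans h'

end

end TracialState

/-- An ultrafilter is nontrivial if it is free (not principal) and contains a sequence of sets with
empty intersection. -/
def Ultrafilter.IsNontrivial {I : Type u} (ω : Ultrafilter I) : Prop :=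
  (∀ i : I, ω ≠ pure i) ∧ ∃ E : ℕ → Set I, (∀ n, E n ∈ ω) ∧ ⋂ n, E n = ∅

section Product

/-- The C⋆-product `∏ i, A i`: the bounded families `(a i)`, with the pointwise operations and the
sup norm. It is Mathlib's `lp A ∞`, under a name of its own so that all its structure comes from one
C⋆-algebra instance. -/
def CStarProduct {I : Type u} (A : I → Type v) [∀ i, CStarAlgebra (A i)] : Type (max u v) :=
  lp A ∞

namespace CStarProduct

variable {I : Type u} {A : I → Type v} [∀ i, CStarAlgebra (A i)]

instance instCoeFun : CoeFun (CStarProduct A) fun _ => ∀ i, A i :=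
  ⟨fun a => (show lp A ∞ from a : ∀ i, A i)⟩

variable [∀ i, Nontrivial (A i)]

/-- `lp A ∞` as a unital C⋆-algebra. -/
noncomputable abbrev lpCStarAlgebra : CStarAlgebra (lp A ∞) where

noncomputable instance instCStarAlgebra : CStarAlgebra (CStarProduct A) :=
  letI : CStarAlgebra (lp A ∞) := lpCStarAlgebra
  inferInstanceAs <| CStarAlgebra (lp A ∞)

noncomputable instance instPartialOrder : PartialOrder (CStarProduct A) :=
  CStarAlgebra.spectralOrder _

instance instStarOrderedRing : StarOrderedRing (CStarProduct A) :=
  CStarAlgebra.spectralOrderedRing _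

@[simp] theorem zero_apply (i : I) : (0 : CStarProduct A) i = 0 := rfl

@[simp] theorem one_apply (i : I) : (1 : CStarProduct A) i = 1 := rfl

@[simp] theorem add_apply (a b : CStarProduct A) (i : I) : (a + b) i = a i + b i := rfl

@[simp] theorem sub_apply (a b : CStarProduct A) (i : I) : (a - b) i = a i - b i := rfl

@[simp] theorem mul_apply (a b : CStarProduct A) (i : I) : (a * b) i = a i * b i := rfl

@[simp] theorem smul_apply (c : ℂ) (a : CStarProduct A) (i : I) : (c • a) i = c • a i := rfl

@[simp] theorem star_apply (a : CStarProduct A) (i : I) : (star a) i = star (a i) := rfl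

theorem norm_eq_iSup (a : CStarProduct A) : ‖a‖ = ⨆ i, ‖a i‖ := rfl

theorem norm_apply_le (a : CStarProduct A) (i : I) : ‖a i‖ ≤ ‖a‖ :=
  lp.norm_apply_le_norm (E := A) ENNReal.top_ne_zero a i

end CStarProduct

variable {I : Type u} {A : I → Type v} [∀ i, CStarAlgebra (A i)] [∀ i, Nontrivial (A i)]

variable (τ : ∀ i, TracialState (A i)) (ω : Ultrafilter I)

/-- The ideal `𝒥₂` of the bounded families `a` with `‖a i‖₂ → 0` along `ω`. -/
def tracialIdeal : Ideal (CStarProduct A) where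
  carrier := {a | Tendsto (fun i => (τ i).norm₂ (a i)) ω (𝓝 0)}
  zero_mem' := by simp [TracialState.norm₂_zero]
  add_mem' {a b} ha hb := by
    refine squeeze_zero (fun i => (τ i).norm₂_nonneg _) (fun i => (τ i).norm₂_add_le (a i) (b i)) ?_
    simpa using Tendsto.add ha hb
  smul_mem' c a ha := by
    refine squeeze_zero (g := fun i => ‖c‖ * (τ i).norm₂ (a i)) (fun i => (τ i).norm₂_nonneg _)
      (fun i => ((τ i).norm₂_mul_le (c i) (a i)).trans ?_) ?_
    · exact mul_le_mul_of_nonneg_right (c.norm_apply_le i)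
        ((τ i).norm₂_nonneg _)
    · simpa using Tendsto.const_mul ‖c‖ ha

theorem mem_tracialIdeal {a : CStarProduct A} :
    a ∈ tracialIdeal τ ω ↔ Tendsto (fun i => (τ i).norm₂ (a i)) ω (𝓝 0) := Iff.rfl

instance tracialIdeal.instIsTwoSided : (tracialIdeal τ ω).IsTwoSided where
  mul_mem_of_left {a} b ha := by
    refine squeeze_zero (g := fun i => (τ i).norm₂ (a i) * ‖b‖) (fun i => (τ i).norm₂_nonneg _)
      (fun i => ((τ i).norm₂_mul_le' (a i) (b i)).trans ?_) ?_
    · exact mul_le_mul_of_nonneg_left (b.norm_apply_le i)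
        ((τ i).norm₂_nonneg _)
    · simpa using Tendsto.mul_const ‖b‖ ((mem_tracialIdeal τ ω).mp ha)

theorem star_mem_tracialIdeal {a : CStarProduct A} (ha : a ∈ tracialIdeal τ ω) :
    star a ∈ tracialIdeal τ ω := by
  rw [mem_tracialIdeal] at ha ⊢
  simpa [TracialState.norm₂_star] using ha

/-- The tracial ultraproduct `∏^ω (A i, τ i)`, i.e. the quotient of the C⋆-product by `𝒥₂`. It
carries the quotient ring and algebra structure, the quotient involution (below), and the quotient
norm. -/
abbrev TracialUltraproduct : Type (max u v) := CStarProduct A ⧸ tracialIdeal τ ω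

noncomputable instance TracialUltraproduct.instStarRing : StarRing (TracialUltraproduct τ ω) where
  star := Quotient.map' star fun a b hab => by
    rw [Submodule.quotientRel_def] at hab ⊢
    rw [← star_sub]
    exact star_mem_tracialIdeal τ ω hab
  star_involutive := by
    rintro ⟨a⟩
    exact congrArg (Ideal.Quotient.mk (tracialIdeal τ ω)) (star_star a)
  star_mul := by
    rintro ⟨a⟩ ⟨b⟩
    exact congrArg (Ideal.Quotient.mk (tracialIdeal τ ω)) (star_mul a b)
  star_add := by
    rintro ⟨a⟩ ⟨b⟩
    exact congrArg (Ideal.Quotient.mk (tracialIdeal τ ω)) (star_add a b)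

theorem TracialUltraproduct.star_mk (a : CStarProduct A) :
    star (Ideal.Quotient.mk (tracialIdeal τ ω) a) = Ideal.Quotient.mk (tracialIdeal τ ω) (star a) :=
  rfl

instance TracialUltraproduct.instStarModule : StarModule ℂ (TracialUltraproduct τ ω) where
  star_smul c := by
    rintro ⟨a⟩
    exact congrArg (Ideal.Quotient.mk (tracialIdeal τ ω)) (star_smul c a)

theorem exists_tendsto_trace (a : CStarProduct A) :
    ∃ z, Tendsto (fun i => (τ i).toLinearMap (a i)) ω (𝓝 z) := by
  obtain ⟨z, -, hz⟩ := (isCompact_closedBall (0 : ℂ) ‖a‖).ultrafilter_le_nhds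
    (ω.map fun i => (τ i).toLinearMap (a i)) (by
      rw [le_principal_iff]
      refine Filter.mem_map.mpr (Filter.univ_mem' fun i => ?_)
      simpa using ((τ i).norm_apply_le (a i)).trans
        (a.norm_apply_le i))
  exact ⟨z, hz⟩

theorem tendsto_trace (a : CStarProduct A) :
    Tendsto (fun i => (τ i).toLinearMap (a i)) ω
      (𝓝 (limUnder (ω : Filter I) fun i => (τ i).toLinearMap (a i))) :=
  tendsto_nhds_limUnder (exists_tendsto_trace τ ω a)

/-- The trace `ρ(a) = lim_{i → ω} τ i (a i)` on the C⋆-product. -/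
noncomputable def limitTrace : CStarProduct A →ₚ[ℂ] ℂ :=
  PositiveLinearMap.mk₀
    { toFun := fun a => limUnder (ω : Filter I) fun i => (τ i).toLinearMap (a i)
      map_add' := fun a b => by
        refine tendsto_nhds_unique (tendsto_trace τ ω (a + b)) ?_
        simpa using (tendsto_trace τ ω a).add (tendsto_trace τ ω b)
      map_smul' := fun c a => by
        refine tendsto_nhds_unique (tendsto_trace τ ω (c • a)) ?_
        simpa using (tendsto_trace τ ω a).const_mul c }
    fun a ha => by
      obtain ⟨b, rfl⟩ := CStarAlgebra.nonneg_iff_eq_star_mul_self.mp ha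
      exact ge_of_tendsto' (tendsto_trace τ ω (star b * b))
        fun i => (τ i).star_mul_self_nonneg (b i)

end Product

/-! Write `ξ` for the image of `1` in the GNS space and `ρ` for the limit trace. Since `ρ` is
tracial, right multiplications are bounded and lie in the commutant. An operator `T` in the double
commutant thus commutes with them, and is determined by `T ξ`. It remains to find `a` with `‖a‖ ≤
‖T‖` and `a ξ = T ξ`.

Density (`apply_one_mem_closure`): if `T ξ` were outside the closure of the image of the `‖T‖`-ball,
Hahn–Banach would separate it by a vector, approximately `b ξ`. But `|⟪b ξ, T ξ⟫|` is at most about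
`‖T‖ ρ(|b|)`, a value nearly attained in the ball at `‖T‖ u`, where `b ≈ u |b|`.

Closedness (`isClosed_toGNS_image_closedBall`): a diagonal choice along `ω` realises each 2-norm
limit of elements of a ball by an element of the same ball. This is where nontriviality of `ω`
enters.

The norm bound on `a` also gives the isometry: each `π_ρ(b)` has a preimage of norm at most
`‖π_ρ(b)‖`. -/

section ApproximatePolar

/-! ### Approximate polar decomposition by functional calculus. -/

variable {B : Type*} [CStarAlgebra B]

attribute [local instance] CStarAlgebra.spectralOrder CStarAlgebra.spectralOrderedRing in
/-- An approximate polar decomposition in a C⋆-algebra: `b = u |b|` with `‖u‖ ≤ 1`, up to `ε`, where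
the positive part is written as a square. -/
theorem CStarAlgebra.exists_approx_polar (b : B) {ε : ℝ} (hε : 0 < ε) :
    ∃ u s : B, ‖u‖ ≤ 1 ∧ IsSelfAdjoint s ∧ b = u * s * s ∧ ‖s * s - star u * b‖ ≤ ε := by
  set h : B := star b * b with hh
  have hsa : IsSelfAdjoint h := .star_mul_self b
  have hnn : ∀ t ∈ spectrum ℝ h, 0 ≤ t := fun _ ht => spectrum_star_mul_self_nonneg _ ht
  -- `g h` is an invertible substitute for `|b| = √h`, so `u = b (g h)⁻¹` makes sense, with `s * s =
  -- g h`. The absolute value only makes `g` positive off the spectrum.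
  set g : ℝ → ℝ := fun t => √(ε ^ 2 + |t|) with hg
  have hgc : Continuous g := by fun_prop
  have hgε : ∀ t, ε ≤ g t := fun t => Real.le_sqrt_of_sq_le (by simp)
  have hg0 : ∀ t, 0 < g t := fun t => hε.trans_le (hgε t)
  have hgsq : ∀ t, g t * g t = ε ^ 2 + |t| := fun t => Real.mul_self_sqrt (by positivity)
  have hic : Continuous fun t => (g t)⁻¹ := hgc.inv₀ fun t => (hg0 t).ne'
  have hit : Continuous fun t => (g t)⁻¹ * t := hic.mul continuous_id
  have hsc : Continuous fun t => √(g t) := hgc.sqrt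
  set s : B := cfc (fun t => √(g t)) h with hs
  set w : B := cfc (fun t => (g t)⁻¹) h with hw
  have hwsa : star w = w := (cfc_predicate (p := IsSelfAdjoint) (fun t => (g t)⁻¹) h).star_eq
  have hss : s * s = cfc g h := by
    rw [hs, ← cfc_mul _ _ h hsc.continuousOn hsc.continuousOn]
    exact congrArg (cfc · h) (funext fun t => Real.mul_self_sqrt (hg0 t).le)
  have hws : w * (s * s) = 1 := by
    rw [hss, hw, ← cfc_mul _ _ h hic.continuousOn hgc.continuousOn, ← cfc_one ℝ h]
    exact congrArg (cfc · h) (funext fun t => inv_mul_cancel₀ (hg0 t).ne')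
  have hid : cfc (fun t : ℝ => t) h = h := cfc_id' ℝ h
  have hwh : w * h = cfc (fun t => (g t)⁻¹ * t) h := by
    conv_lhs => rw [hw]; arg 2; rw [← hid]
    rw [← cfc_mul _ (fun t => t) h hic.continuousOn]
  have hwhw : w * h * w = cfc (fun t => (g t)⁻¹ * t * (g t)⁻¹) h := by
    rw [hwh, hw, ← cfc_mul _ _ h hit.continuousOn hic.continuousOn]
  refine ⟨b * w, s, ?_, cfc_predicate (p := IsSelfAdjoint) _ h, ?_, ?_⟩
  -- `star u * u` is the function `t / (ε² + t) ≤ 1` of `h`.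
  · have h1 : ‖b * w‖ * ‖b * w‖ ≤ 1 := by
      rw [← CStarRing.norm_star_mul_self, star_mul, hwsa, mul_assoc, ← mul_assoc (star b), ← hh,
        ← mul_assoc, hwhw]
      refine norm_cfc_le zero_le_one fun t ht => ?_
      have ht0 := hnn t ht
      rw [Real.norm_of_nonneg (by have := hg0 t; positivity), mul_right_comm, ← mul_inv, hgsq,
        abs_of_nonneg ht0, inv_mul_le_iff₀ (by positivity)]
      nlinarith
    nlinarith [norm_nonneg (b * w)]
  · rw [mul_assoc, mul_assoc, hws, mul_one]
  · rw [star_mul, hwsa, mul_assoc, ← hh, hwh, hss,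
      ← cfc_sub _ _ h hgc.continuousOn hit.continuousOn]
    refine norm_cfc_le hε.le fun t ht => ?_
    have ht0 := hnn t ht
    -- The error is `ε² / g t ≤ ε`, because `g t ≥ ε`.
    have h2 : g t - (g t)⁻¹ * t = (g t)⁻¹ * ε ^ 2 := by
      have := hgsq t
      rw [abs_of_nonneg ht0] at this
      have := (hg0 t).ne'
      field_simp
      linarith
    rw [h2, Real.norm_of_nonneg (by have := hg0 t; positivity), inv_mul_le_iff₀ (hg0 t), sq]
    exact mul_le_mul_of_nonneg_right (hgε t) hε.le

end ApproximatePolar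

/-! ### The GNS space of a positive functional. -/

namespace PositiveLinearMap

open UniformSpace Completion
open scoped InnerProductSpace

variable {B : Type*} [CStarAlgebra B] [PartialOrder B] [StarOrderedRing B] (f : B →ₚ[ℂ] ℂ)

/-- The canonical linear map of a C⋆-algebra into its GNS space. -/
noncomputable def toGNS : B →ₗ[ℂ] f.GNS :=
  (toComplL : f.PreGNS →L[ℂ] f.GNS).toLinearMap ∘ₗ f.toPreGNS.toLinearMap

theorem denseRange_toGNS : DenseRange f.toGNS :=
  (denseRange_coe (α := f.PreGNS)).comp f.toPreGNS.surjective.denseRange (continuous_coe _)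

theorem toGNS_induction {p : f.GNS → Prop} (hp : IsClosed {x | p x}) (h : ∀ a, p (f.toGNS a))
    (x : f.GNS) : p x :=
  f.denseRange_toGNS.induction_on x hp h

theorem norm_toGNS (a : B) : ‖f.toGNS a‖ = ‖f.toPreGNS a‖ := norm_coe _

theorem inner_toGNS (a b : B) : ⟪f.toGNS a, f.toGNS b⟫_ℂ = f (star a * b) := inner_coe _ _

@[simp]
theorem gnsStarAlgHom_toGNS (a b : B) : f.gnsStarAlgHom a (f.toGNS b) = f.toGNS (a * b) :=
  f.gnsNonUnitalStarAlgHom_apply_coe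

theorem norm_toGNS_mul_le (a b : B) : ‖f.toGNS (a * b)‖ ≤ ‖a‖ * ‖f.toGNS b‖ := by
  rw [← gnsStarAlgHom_toGNS]
  exact (f.gnsStarAlgHom a).le_of_opNorm_le (NonUnitalStarAlgHom.norm_apply_le _ a) _

theorem norm_toGNS_le (a : B) : ‖f.toGNS a‖ ≤ ‖a‖ * ‖f.toGNS 1‖ := by
  simpa using f.norm_toGNS_mul_le a 1

theorem re_inner_toGNS_self (s : B) (hs : IsSelfAdjoint s) : (f (s * s)).re = ‖f.toGNS s‖ ^ 2 := by
  rw [← inner_self_eq_norm_sq (𝕜 := ℂ), inner_toGNS, hs.star_eq]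
  rfl

theorem norm_apply_le_mul_norm_toGNS_one (a : B) : ‖f a‖ ≤ ‖f.toGNS 1‖ ^ 2 * ‖a‖ := by
  have h := norm_inner_le_norm (𝕜 := ℂ) (f.toGNS 1) (f.toGNS a)
  rw [inner_toGNS, star_one, one_mul] at h
  nlinarith [mul_le_mul_of_nonneg_left (f.norm_toGNS_le a) (norm_nonneg (f.toGNS 1))]

/-! ### Tracial functionals: right multiplications and density. -/

variable {f}

theorem norm_toGNS_star (hf : ∀ a b, f (a * b) = f (b * a)) (a : B) :
    ‖f.toGNS (star a)‖ = ‖f.toGNS a‖ := by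
  rw [← sq_eq_sq₀ (norm_nonneg _) (norm_nonneg _), ← inner_self_eq_norm_sq (𝕜 := ℂ),
    ← inner_self_eq_norm_sq (𝕜 := ℂ), inner_toGNS, inner_toGNS, hf, star_star]

theorem norm_toGNS_mul_le' (hf : ∀ a b, f (a * b) = f (b * a)) (a b : B) :
    ‖f.toGNS (a * b)‖ ≤ ‖b‖ * ‖f.toGNS a‖ := by
  rw [← norm_toGNS_star hf, star_mul, ← norm_toGNS_star hf a, ← norm_star b]
  exact f.norm_toGNS_mul_le _ _

/-- Right multiplication by `b`, as a bounded operator on the GNS space of a tracial functional. -/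
noncomputable def rightMulGNS (hf : ∀ a b, f (a * b) = f (b * a)) (b : B) : f.GNS →L[ℂ] f.GNS :=
  ((f.toPreGNS.toLinearMap ∘ₗ LinearMap.mulRight ℂ b ∘ₗ f.ofPreGNS.toLinearMap).mkContinuous ‖b‖
    fun x => by
      have h := norm_toGNS_mul_le' hf (f.ofPreGNS x) b
      rwa [norm_toGNS, norm_toGNS] at h).completion

@[simp]
theorem rightMulGNS_toGNS (hf : ∀ a b, f (a * b) = f (b * a)) (a b : B) :
    rightMulGNS hf b (f.toGNS a) = f.toGNS (a * b) :=
  ContinuousLinearMap.completion_apply_coe _ _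

/-- Associativity, checked on a dense subspace. This is the only part of the commutant that the
double commutant argument needs. -/
theorem rightMulGNS_mem_centralizer (hf : ∀ a b, f (a * b) = f (b * a)) (b : B) :
    rightMulGNS hf b ∈ Set.centralizer (Set.range f.gnsStarAlgHom) := by
  rintro _ ⟨a, rfl⟩
  ext x
  induction x using f.toGNS_induction with
  | hp => exact isClosed_eq (by fun_prop) (by fun_prop)
  | h c => simp [mul_assoc, -gnsStarAlgHom_apply]

theorem inner_rightMulGNS_left (hf : ∀ a b, f (a * b) = f (b * a)) {s : B} (hs : IsSelfAdjoint s)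
    (x y : f.GNS) : ⟪rightMulGNS hf s x, y⟫_ℂ = ⟪x, rightMulGNS hf s y⟫_ℂ := by
  induction x using f.toGNS_induction with
  | hp => exact isClosed_eq (by fun_prop) (by fun_prop)
  | h a =>
    induction y using f.toGNS_induction with
    | hp => exact isClosed_eq (by fun_prop) (by fun_prop)
    | h b =>
      rw [rightMulGNS_toGNS, rightMulGNS_toGNS, inner_toGNS, inner_toGNS, star_mul, hs.star_eq,
        mul_assoc, hf, mul_assoc]

/-- An operator that commutes with the right multiplications acts on the GNS space as `a ∈ B` does
as soon as it does so on the cyclic vector. -/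
theorem eq_gnsStarAlgHom_of_apply_one (hf : ∀ a b, f (a * b) = f (b * a)) {T : f.GNS →L[ℂ] f.GNS}
    (hT : ∀ b, T * rightMulGNS hf b = rightMulGNS hf b * T) {a : B}
    (ha : T (f.toGNS 1) = f.toGNS a) : T = f.gnsStarAlgHom a := by
  ext x
  induction x using f.toGNS_induction with
  | hp => exact isClosed_eq (by fun_prop) (by fun_prop)
  | h b => simpa [ha, -gnsStarAlgHom_apply] using congr($(hT b) (f.toGNS 1))

/-- One factor `s` moves across the inner product as a self-adjoint right multiplication, then
through `T`, leaving `⟪u s ξ, T (s ξ)⟫`. Splitting `s * s` evenly in this way gives a bound by the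
trace of `s * s`. -/
theorem norm_inner_apply_one_le (hf : ∀ a b, f (a * b) = f (b * a)) {T : f.GNS →L[ℂ] f.GNS}
    (hT : ∀ b, T * rightMulGNS hf b = rightMulGNS hf b * T) {u s : B} (hu : ‖u‖ ≤ 1)
    (hs : IsSelfAdjoint s) :
    ‖⟪f.toGNS (u * s * s), T (f.toGNS 1)⟫_ℂ‖ ≤ ‖T‖ * (f (s * s)).re := by
  have h : rightMulGNS hf s (T (f.toGNS 1)) = T (f.toGNS s) := by
    simpa using congr($(hT s) (f.toGNS 1)).symm
  rw [← rightMulGNS_toGNS hf, inner_rightMulGNS_left hf hs, h, re_inner_toGNS_self _ s hs]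
  calc _ ≤ ‖f.toGNS (u * s)‖ * ‖T (f.toGNS s)‖ := norm_inner_le_norm _ _
    _ ≤ ‖f.toGNS s‖ * (‖T‖ * ‖f.toGNS s‖) := by
        gcongr
        · exact (f.norm_toGNS_mul_le u s).trans (mul_le_of_le_one_left (norm_nonneg _) hu)
        · exact T.le_opNorm _
    _ = _ := by ring

/-- Testing the hypothesis on `‖T‖ u` bounds `‖T‖ f(star u * b)` in real part by `c`. Up to `ε` this
is the upper bound `‖T‖ f(s * s)` of the previous lemma. -/
theorem re_inner_toGNS_apply_one_le (hf : ∀ a b, f (a * b) = f (b * a)) {T : f.GNS →L[ℂ] f.GNS}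
    (hT : ∀ b, T * rightMulGNS hf b = rightMulGNS hf b * T) (b : B) {c : ℝ}
    (hc : ∀ a : B, ‖a‖ ≤ ‖T‖ → (⟪f.toGNS b, f.toGNS a⟫_ℂ).re ≤ c) :
    (⟪f.toGNS b, T (f.toGNS 1)⟫_ℂ).re ≤ c := by
  set K : ℝ := ‖T‖ * ‖f.toGNS 1‖ ^ 2 with hK
  have key : ∀ ε : ℝ, 0 < ε → (⟪f.toGNS b, T (f.toGNS 1)⟫_ℂ).re ≤ c + K * ε := fun ε hε => by
    obtain ⟨u, s, hu, hs, hb, hle⟩ := CStarAlgebra.exists_approx_polar b hε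
    have h1 := norm_inner_apply_one_le hf hT hu hs
    rw [← hb] at h1
    have h2 := hc ((‖T‖ : ℂ) • u) (by
      rw [norm_smul, Complex.norm_real, norm_norm]
      exact mul_le_of_le_one_right (norm_nonneg _) hu)
    rw [map_smul, inner_smul_right, Complex.re_ofReal_mul,
      ← inner_conj_symm, Complex.conj_re, inner_toGNS] at h2
    have h3 := (Complex.re_le_norm _).trans (f.norm_apply_le_mul_norm_toGNS_one (s * s - star u * b))
    rw [map_sub, Complex.sub_re] at h3
    have h4 : (f (s * s)).re ≤ (f (star u * b)).re + ‖f.toGNS 1‖ ^ 2 * ε := by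
      have := mul_le_mul_of_nonneg_left hle (sq_nonneg ‖f.toGNS 1‖)
      linarith
    calc _ ≤ _ := Complex.re_le_norm _
      _ ≤ _ := h1
      _ ≤ ‖T‖ * ((f (star u * b)).re + ‖f.toGNS 1‖ ^ 2 * ε) := by gcongr
      _ ≤ _ := by rw [hK]; linarith
  have h : Tendsto (fun ε : ℝ => c + K * ε) (𝓝[>] 0) (𝓝 c) := by
    have : Continuous fun ε : ℝ => c + K * ε := by fun_prop
    simpa using (this.tendsto 0).mono_left nhdsWithin_le_nhds
  exact ge_of_tendsto h (eventually_mem_nhdsWithin.mono key)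

/-- Density of the vectors `b ξ`: both `T ξ` and the competing `a ξ` have norm at most `K`, so
replacing `z` by `b ξ` costs `K ‖z - b ξ‖` twice. -/
theorem re_inner_apply_one_le (hf : ∀ a b, f (a * b) = f (b * a)) {T : f.GNS →L[ℂ] f.GNS}
    (hT : ∀ b, T * rightMulGNS hf b = rightMulGNS hf b * T) (z : f.GNS) {c : ℝ}
    (hc : ∀ a : B, ‖a‖ ≤ ‖T‖ → (⟪z, f.toGNS a⟫_ℂ).re ≤ c) :
    (⟪z, T (f.toGNS 1)⟫_ℂ).re ≤ c := by
  set K : ℝ := ‖T‖ * ‖f.toGNS 1‖ with hK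
  have key : ∀ b : B,
      (⟪z, T (f.toGNS 1)⟫_ℂ).re ≤ c + 2 * K * ‖z - f.toGNS b‖ := fun b => by
    have hre : ∀ y : f.GNS, |(⟪z, y⟫_ℂ).re - (⟪f.toGNS b, y⟫_ℂ).re| ≤ ‖z - f.toGNS b‖ * ‖y‖ :=
      fun y => by
        rw [← Complex.sub_re, ← inner_sub_left]
        exact (Complex.abs_re_le_norm _).trans (norm_inner_le_norm _ _)
    have h1 := re_inner_toGNS_apply_one_le hf hT b (c := c + ‖z - f.toGNS b‖ * K) fun a ha => by
      have h2 := (abs_le.mp (hre (f.toGNS a))).1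
      have h3 : ‖f.toGNS a‖ ≤ K :=
        (f.norm_toGNS_le a).trans (mul_le_mul_of_nonneg_right ha (norm_nonneg _))
      have := mul_le_mul_of_nonneg_left h3 (norm_nonneg (z - f.toGNS b))
      linarith [hc a ha]
    have h2 := (abs_le.mp (hre (T (f.toGNS 1)))).2
    have := mul_le_mul_of_nonneg_left (T.le_opNorm (f.toGNS 1)) (norm_nonneg (z - f.toGNS b))
    linarith
  have h := f.toGNS_induction
    (p := fun y => (⟪z, T (f.toGNS 1)⟫_ℂ).re ≤ c + 2 * K * ‖z - y‖)
    (isClosed_le continuous_const (by fun_prop)) key z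
  simpa using h

/-- A Kaplansky-type density theorem for the GNS representation of a tracial functional: an operator
that commutes with the right multiplications is approximated on the cyclic vector by elements of
norm at most `‖T‖`. -/
theorem apply_one_mem_closure (hf : ∀ a b, f (a * b) = f (b * a)) {T : f.GNS →L[ℂ] f.GNS}
    (hT : ∀ b, T * rightMulGNS hf b = rightMulGNS hf b * T) :
    T (f.toGNS 1) ∈ closure (f.toGNS '' Metric.closedBall 0 ‖T‖) := by
  by_contra hmem
  have hconv : Convex ℝ (f.toGNS '' Metric.closedBall 0 ‖T‖) :=
    (convex_closedBall (0 : B) ‖T‖).is_linear_image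
      (f.toGNS.restrictScalars ℝ).isLinear
  obtain ⟨φ, c, hlt, hgt⟩ :=
    RCLike.geometric_hahn_banach_closed_point (𝕜 := ℂ) hconv.closure isClosed_closure hmem
  set z := (InnerProductSpace.toDual ℂ f.GNS).symm φ
  have hz : ∀ y, φ y = ⟪z, y⟫_ℂ := fun y => InnerProductSpace.toDual_symm_apply.symm
  refine hgt.not_ge ?_
  rw [hz]
  refine re_inner_apply_one_le hf hT z fun a ha => ?_
  rw [← hz]
  exact (hlt _ (subset_closure ⟨a, by simpa using ha, rfl⟩)).le

end PositiveLinearMap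

section Ultraproduct

variable {I : Type u} {A : I → Type v} [∀ i, CStarAlgebra (A i)]

/-- A bounded family of elements of the algebras `A i`, as an element of the C⋆-product. -/
def CStarProduct.ofBounded (a : ∀ i, A i) (r : ℝ) (h : ∀ i, ‖a i‖ ≤ r) : CStarProduct A :=
  (⟨a, memℓp_infty ⟨r, by rintro _ ⟨i, rfl⟩; exact h i⟩⟩ : lp A ∞)

variable [∀ i, Nontrivial (A i)] (τ : ∀ i, TracialState (A i)) (ω : Ultrafilter I)

open PositiveLinearMap

theorem tendsto_limitTrace (a : CStarProduct A) :
    Tendsto (fun i => (τ i).toLinearMap (a i)) ω (𝓝 (limitTrace τ ω a)) :=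
  tendsto_trace τ ω a

theorem limitTrace_mul_comm (a b : CStarProduct A) :
    limitTrace τ ω (a * b) = limitTrace τ ω (b * a) := by
  refine tendsto_nhds_unique (tendsto_limitTrace τ ω (a * b)) ?_
  simpa [(τ _).map_mul_comm] using tendsto_limitTrace τ ω (b * a)

theorem tendsto_norm₂ (a : CStarProduct A) :
    Tendsto (fun i => (τ i).norm₂ (a i)) ω (𝓝 ‖(limitTrace τ ω).toGNS a‖) := by
  rw [norm_toGNS, preGNS_norm_def]
  exact ((Complex.continuous_re.tendsto _).comp (tendsto_limitTrace τ ω (star a * a))).sqrt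

theorem mem_tracialIdeal_iff_toGNS_eq_zero {a : CStarProduct A} :
    a ∈ tracialIdeal τ ω ↔ (limitTrace τ ω).toGNS a = 0 := by
  rw [mem_tracialIdeal, ← norm_eq_zero]
  exact ⟨tendsto_nhds_unique (tendsto_norm₂ τ ω a), fun h => h ▸ tendsto_norm₂ τ ω a⟩

/-- The cyclic vector is separating: if `a ξ = 0`, then the zero operator, which commutes with right
multiplications, agrees with `a` at `ξ`. -/
theorem mem_tracialIdeal_iff_gnsStarAlgHom_eq_zero {a : CStarProduct A} :
    a ∈ tracialIdeal τ ω ↔ (limitTrace τ ω).gnsStarAlgHom a = 0 := by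
  rw [mem_tracialIdeal_iff_toGNS_eq_zero]
  refine ⟨fun h => ?_, fun h => ?_⟩
  · exact (eq_gnsStarAlgHom_of_apply_one (limitTrace_mul_comm τ ω) (T := 0) (by simp)
      (by simp [h])).symm
  · simpa [-gnsStarAlgHom_apply] using congr($h ((limitTrace τ ω).toGNS 1))

theorem CStarProduct.norm_ofBounded_le (a : ∀ i, A i) {r : ℝ} (hr : 0 ≤ r) (h : ∀ i, ‖a i‖ ≤ r) :
    ‖CStarProduct.ofBounded a r h‖ ≤ r := by
  rw [CStarProduct.norm_eq_iSup]
  exact Real.iSup_le h hr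

/-! ### Countable saturation and the double commutant. -/

variable {ω}

/-- Countable saturation: along a nontrivial ultrafilter, countably many conditions on `(n, i)`, each
true for `ω`-almost all `i`, can be met with one choice `N i` of `n` that tends to infinity. -/
theorem Ultrafilter.IsNontrivial.exists_diagonal (hω : ω.IsNontrivial) {p : ℕ → I → Prop}
    (hp : ∀ n, ∀ᶠ i in ω, p n i) :
    ∃ N : I → ℕ, ∀ n, ∀ᶠ i in ω, n ≤ N i ∧ p (N i) i := by
  classical
  obtain ⟨-, E, hE, hE0⟩ := hω
  -- Every `i` leaves some `E n`, so a first failure exists even if `p k i` holds for all `k`.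
  have hex : ∀ i, ∃ n, ¬ ∀ k ≤ n, i ∈ E k ∧ p k i := fun i => by
    have : i ∉ ⋂ n, E n := by simp [hE0]
    obtain ⟨n, hn⟩ := by simpa using this
    exact ⟨n, fun h => hn (h n le_rfl).1⟩
  -- The last index before the first failure. If the failure is at `0`, the truncated value `0` is
  -- junk, but this occurs only off an `ω`-large set.
  refine ⟨fun i => Nat.find (hex i) - 1, fun n => ?_⟩
  have hev : ∀ᶠ i in ω, ∀ k ∈ Set.Iic n, i ∈ E k ∧ p k i :=
    (Set.finite_Iic n).eventually_all.mpr fun k _ => (show ∀ᶠ i in ω, i ∈ E k from hE k).and (hp k)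
  filter_upwards [hev] with i hi
  have hlt : n < Nat.find (hex i) := by
    rw [Nat.lt_find_iff]
    intro m hm
    rw [not_not]
    exact fun k hk => hi k (hk.trans hm)
  have hN := Nat.find_min (hex i) (Nat.sub_one_lt_of_lt hlt)
  rw [not_not] at hN
  exact ⟨Nat.le_sub_one_of_lt hlt, (hN _ le_rfl).2⟩

/-- The ball of radius `r` of the C⋆-product has closed image in the GNS space of the limit trace. -/
theorem isClosed_toGNS_image_closedBall (hω : ω.IsNontrivial) {r : ℝ} (hr : 0 ≤ r) :
    IsClosed ((limitTrace τ ω).toGNS '' Metric.closedBall 0 r) := by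
  set f := limitTrace τ ω
  refine isClosed_of_closure_subset fun y hy => ?_
  have hδ : ∀ n : ℕ, (0 : ℝ) < 1 / (n + 1) := fun n => Nat.one_div_pos_of_nat
  have hap : ∀ n : ℕ, ∃ a : CStarProduct A, ‖a‖ ≤ r ∧ ‖f.toGNS a - y‖ < 1 / (n + 1) := fun n => by
    obtain ⟨_, ⟨a, ha, rfl⟩, hd⟩ := Metric.mem_closure_iff.mp hy _ (hδ n)
    exact ⟨a, by simpa using ha, by rwa [dist_comm, dist_eq_norm] at hd⟩
  choose a har hay using hap
  -- Each `a n` is compared with all earlier terms, so that at `N i ≥ n` the diagonal term is close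
  -- to `a n`.
  have hp : ∀ n, ∀ᶠ i in ω, ∀ k ∈ Set.Iic n,
      (τ i).norm₂ (a n i - a k i) < 1 / (n + 1) + 1 / (k + 1) := fun n =>
    (Set.finite_Iic n).eventually_all.mpr fun k _ => by
      refine (tendsto_norm₂ τ ω (a n - a k)).eventually_lt_const ?_
      rw [map_sub, ← sub_sub_sub_cancel_right _ _ y]
      exact (norm_sub_le _ _).trans_lt (add_lt_add (hay n) (hay k))
  obtain ⟨N, hN⟩ := hω.exists_diagonal hp
  have hb : ∀ i, ‖a (N i) i‖ ≤ r := fun i => ((a (N i)).norm_apply_le i).trans (har _)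
  set b := CStarProduct.ofBounded (fun i => a (N i) i) r hb
  refine ⟨b, by simpa using CStarProduct.norm_ofBounded_le _ hr hb, ?_⟩
  -- Two of the three parts come from `b - a n`, since `1 / (N i + 1) ≤ 1 / (n + 1)`; the third is
  -- the distance from `a n` to `y`.
  have hle : ∀ n : ℕ, ‖f.toGNS b - y‖ ≤ 3 * (1 / (n + 1)) := fun n => by
    have h1 : ‖f.toGNS (b - a n)‖ ≤ 2 * (1 / (n + 1)) := by
      refine le_of_tendsto (tendsto_norm₂ τ ω (b - a n)) ?_
      filter_upwards [hN n] with i hi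
      have h2 : (1 : ℝ) / (N i + 1) ≤ 1 / (n + 1) := Nat.one_div_le_one_div hi.1
      have h3 := hi.2 n hi.1
      change (τ i).norm₂ (a (N i) i - a n i) ≤ _
      linarith
    rw [map_sub] at h1
    have h4 := norm_sub_le_norm_sub_add_norm_sub (f.toGNS b) (f.toGNS (a n)) y
    linarith [hay n]
  have hlim : Tendsto (fun n : ℕ => 3 * (1 / ((n : ℝ) + 1))) atTop (𝓝 0) := by
    simpa using (tendsto_one_div_add_atTop_nhds_zero_nat (𝕜 := ℝ)).const_mul 3
  exact sub_eq_zero.mp (norm_le_zero_iff.mp (ge_of_tendsto' hlim hle))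

/-- Every operator in the double commutant of the image of the C⋆-product lies in the image, with a
preimage of norm at most its own. -/
theorem exists_gnsStarAlgHom_eq (hω : ω.IsNontrivial)
    {T : (limitTrace τ ω).GNS →L[ℂ] (limitTrace τ ω).GNS}
    (hT : T ∈ Set.centralizer (Set.centralizer (Set.range (limitTrace τ ω).gnsStarAlgHom))) :
    ∃ a : CStarProduct A, ‖a‖ ≤ ‖T‖ ∧ (limitTrace τ ω).gnsStarAlgHom a = T := by
  have hf := limitTrace_mul_comm τ ω
  have hTR : ∀ b, T * rightMulGNS hf b = rightMulGNS hf b * T := fun b =>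
    (hT _ (rightMulGNS_mem_centralizer hf b)).symm
  have h := apply_one_mem_closure hf hTR
  rw [(isClosed_toGNS_image_closedBall τ hω (norm_nonneg T)).closure_eq] at h
  obtain ⟨a, ha, haT⟩ := h
  exact ⟨a, by simpa using ha, (eq_gnsStarAlgHom_of_apply_one hf hTR haT.symm).symm⟩

/-! ### The induced representation: injective, isometric, with von Neumann range. -/

variable (ω) in
/-- The injective representation of the tracial ultraproduct induced by the GNS representation of
the limit trace. -/
noncomputable def TracialUltraproduct.gnsHom : TracialUltraproduct τ ω →⋆ₐ[ℂ]
    ((limitTrace τ ω).GNS →L[ℂ] (limitTrace τ ω).GNS) where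
  __ := Ideal.Quotient.liftₐ (tracialIdeal τ ω) (limitTrace τ ω).gnsStarAlgHom.toAlgHom
    fun _ ha => (mem_tracialIdeal_iff_gnsStarAlgHom_eq_zero τ ω).mp ha
  map_star' := by
    rintro ⟨a⟩
    exact map_star (limitTrace τ ω).gnsStarAlgHom a

variable (ω) in
theorem TracialUltraproduct.gnsHom_mk (a : CStarProduct A) :
    gnsHom τ ω (Ideal.Quotient.mk (tracialIdeal τ ω) a) = (limitTrace τ ω).gnsStarAlgHom a := rfl

variable (ω) in
theorem TracialUltraproduct.gnsHom_injective : Function.Injective (gnsHom τ ω) := by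
  refine (injective_iff_map_eq_zero _).mpr fun x hx => ?_
  obtain ⟨a, rfl⟩ := Ideal.Quotient.mk_surjective x
  exact Ideal.Quotient.eq_zero_iff_mem.mpr
    ((mem_tracialIdeal_iff_gnsStarAlgHom_eq_zero τ ω).mpr hx)

/-- `≤` holds because a `⋆`-homomorphism contracts every lift. For `≥`, the image of `x` lies in the
double commutant and so has a preimage of no larger norm, which injectivity identifies as a lift of
`x`. -/
theorem TracialUltraproduct.norm_gnsHom (hω : ω.IsNontrivial) (x : TracialUltraproduct τ ω) :
    ‖gnsHom τ ω x‖ = ‖x‖ := by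
  refine le_antisymm (le_of_forall_pos_le_add fun ε hε => ?_) ?_
  · obtain ⟨a, rfl, ha⟩ := Submodule.Quotient.norm_mk_lt x hε
    exact (NonUnitalStarAlgHom.norm_apply_le (limitTrace τ ω).gnsStarAlgHom a).trans ha.le
  · obtain ⟨b, rfl⟩ := Ideal.Quotient.mk_surjective x
    obtain ⟨a, ha, hab⟩ := exists_gnsStarAlgHom_eq τ hω
      (Set.subset_centralizer_centralizer ⟨b, rfl⟩)
    rw [gnsHom_mk, ← (gnsHom_injective τ ω hab :
      Ideal.Quotient.mk (tracialIdeal τ ω) a = Ideal.Quotient.mk (tracialIdeal τ ω) b)]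
    exact (Submodule.Quotient.norm_mk_le _ a).trans ha

variable (ω) in
theorem TracialUltraproduct.coe_range_gnsHom :
    ((gnsHom τ ω).range : Set ((limitTrace τ ω).GNS →L[ℂ] (limitTrace τ ω).GNS)) =
      Set.range (limitTrace τ ω).gnsStarAlgHom :=
  Ideal.Quotient.mk_surjective.range_comp (gnsHom τ ω) |>.symm

/-- The image of the tracial ultraproduct on the GNS space, as a von Neumann algebra. -/
noncomputable def TracialUltraproduct.vonNeumannAlgebra (hω : ω.IsNontrivial) :
    VonNeumannAlgebra (limitTrace τ ω).GNS where
  toStarSubalgebra := (gnsHom τ ω).range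
  centralizer_centralizer' := by
    have h : (gnsHom τ ω).range.carrier = Set.range (limitTrace τ ω).gnsStarAlgHom :=
      coe_range_gnsHom τ ω
    rw [h]
    refine subset_antisymm (fun T hT => ?_) Set.subset_centralizer_centralizer
    obtain ⟨a, -, ha⟩ := exists_gnsStarAlgHom_eq τ hω hT
    exact ⟨a, ha⟩

end Ultraproduct

theorem mainTheorem2 {I : Type u} (A : I → Type v) [∀ i, CStarAlgebra (A i)]
    [∀ i, Nontrivial (A i)] (τ : ∀ i, TracialState (A i)) (ω : Ultrafilter I)
    (hω : ω.IsNontrivial) :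
    ∃ (M : VonNeumannAlgebra (limitTrace τ ω).GNS) (e : TracialUltraproduct τ ω ≃⋆ₐ[ℂ] M.toStarSubalgebra),
      (∀ a : CStarProduct A, (e (Ideal.Quotient.mk (tracialIdeal τ ω) a) :
        (limitTrace τ ω).GNS →L[ℂ] (limitTrace τ ω).GNS) = (limitTrace τ ω).gnsStarAlgHom a) ∧
      ∀ x : TracialUltraproduct τ ω, ‖e x‖ = ‖x‖ :=
  ⟨TracialUltraproduct.vonNeumannAlgebra τ hω,
    StarAlgEquiv.ofInjective (TracialUltraproduct.gnsHom τ ω)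
      (TracialUltraproduct.gnsHom_injective τ ω),
    fun _ => rfl, TracialUltraproduct.norm_gnsHom τ hω⟩
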